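/- For positive integers $k_1,\dots,k_r$ with $k_r>1$ let \[ \zeta(k_1,\dots,k_r)=\sum_{0<m_1<\cdots<m_r}\frac{1}{m_1^{k_1}\cdots m_r^{k_r}} \] be the multiple zeta value (a convergent series). An index of depth $j$ is a tuple $\mathbf a=(a_1,\dots,a_j)$ of positive integers; its weight is $\mathrm{wt}(\mathbf a)=a_1+\cdots+a_j$, its depth is $\mathrm{dep}(\mathbf a)=j$, and its height is the number of $i$ with $a_i>1$. For two indices $\mathbf a,\mathbf b$ of the same depth $j$ write $\zeta(\mathbf a+\mathbf b)=\zeta(a_1+b_1,\dots,a_j+b_j)$. For all integers $r,k\ge 1$, the series for all multiple zeta values in the following formula converge, and \[ \zeta(\underbrace{1,\dots,1}_{r-1},k+1)=\sum_{j=1}^{\min(r,k)}(-1)^{j-1}\sum_{\substack{\mathrm{wt}(\mathbf a)=k,\ \mathrm{wt}(\mathbf b)=r\\ \mathrm{dep}(\mathbf a)=\mathrm{dep}(\mathbf b)=j}}\zeta(\mathbf a+\mathbf b), \] where the inner sum runs over all ordered pairs $(\mathbf a,\mathbf b)$ of indices satisfying the stated conditions. Moreover, the right-hand side is symmetric in $r$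 and $k$, and every index $\mathbf a+\mathbf b$ occurring in it has maximal height, that is, all its entries are greater than one. -/

import Mathlib

namespace MZV

/-- The weight of a tuple of exponents. -/
def weight {r : ℕ} (k : Fin r → ℕ) : ℕ := ∑ i, k i

/-- The height of a tuple of exponents: the number of entries greater than one. -/
def height {r : ℕ} (k : Fin r → ℕ) : ℕ := (Finset.univ.filter fun i => 1 < k i).card

/-- The range of summation `0 < m₁ < ⋯ < m_r`. -/
def chains (r : ℕ) : Set (Fin r → ℕ) := {m | (∀ i, 0 < m i) ∧ StrictMono m}

/-- The term `1 / (m₁ ^ k₁ ⋯ m_r ^ k_r)`. -/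
noncomputable def term {r : ℕ} (k m : Fin r → ℕ) : ℝ := 1 / ∏ i, (m i : ℝ) ^ k i

/-- Convergence of the nested series of `k` (all terms are nonnegative). -/
def Converges {r : ℕ} (k : Fin r → ℕ) : Prop :=
  Summable fun m : chains r => term k m

/-- The multiple zeta value `ζ(k₁, …, k_r) = ∑_{0 < m₁ < ⋯ < m_r} 1 / (m₁ ^ k₁ ⋯ m_r ^ k_r)`. -/
noncomputable def zeta {r : ℕ} (k : Fin r → ℕ) : ℝ := ∑' m : chains r, term k m

/-- The indices (tuples of positive integers) of depth `j` and weight `n`. -/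
def indices (j n : ℕ) : Finset (Fin j → ℕ) :=
  (Fintype.piFinset fun _ => Finset.range (n + 1)).filter fun a => (∀ i, 0 < a i) ∧ weight a = n

theorem mem_indices {j n : ℕ} {a : Fin j → ℕ} :
    a ∈ indices j n ↔ (∀ i, 0 < a i) ∧ weight a = n := by
  simp only [indices, Finset.mem_filter, Fintype.mem_piFinset, Finset.mem_range,
    and_iff_right_iff_imp]
  rintro ⟨_, rfl⟩ i
  exact Nat.lt_succ_of_le (Finset.single_le_sum (fun _ _ => Nat.zero_le _) (Finset.mem_univ i))

/-- The index `(1, …, 1, k + 1)` of depth `r`, with `r - 1` ones (for `r ≥ 1`). -/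
def heightOneIndex (r k : ℕ) : Fin r → ℕ := fun i => if (i : ℕ) + 1 = r then k + 1 else 1

/-- `∑_{j=1}^{min(r,k)} (-1)^(j-1) ∑ ζ(a + b)`, the inner sum over the indices `a`, `b` of depth `j`
with `wt(a) = k` and `wt(b) = r`. -/
noncomputable def maxHeightSum (r k : ℕ) : ℝ :=
  ∑ j ∈ Finset.Icc 1 (min r k),
    (-1 : ℝ) ^ (j - 1) * ∑ a ∈ indices j k, ∑ b ∈ indices j r, zeta (a + b)

end MZV

/-!
The two sides are compared through generating functions. Formally,
`∏ₙ (1 - x y / ((n - x) (n - y)))` expands, by `x / (n - x) = ∑_{a ≥ 1} xᵃ / nᵃ`, into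
`1 - ∑_{r, k} maxHeightSum r k · xʳ yᵏ`, while each factor equals
`n (n - x - y) / ((n - x) (n - y))`, so that Gauss's summation of `₂F₁(x, -y; 1 - y; 1)` turns the
product into `1 - ∑_{r, k} ζ(1, …, 1, k + 1) xʳ yᵏ`.

To avoid analysis in two variables the product is cut off at `n ≤ N`. Its partial fraction expansion
in `y` is the exact identity (`MZV.prod_one_sub_eq_one_sub_sum`)

  `∏_{n ≤ N} (1 - x y / ((n - x) (n - y)))
    = 1 - ∑_{m ≤ N} x y / (m (m - y)) · ∏_{i < m} (1 + x / i) · ∏_{N - m < i ≤ N} (1 - x / i)⁻¹`,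

a terminating form of Gauss's summation, proved by induction on `N` and a telescoping sum. It is
read in the fraction field of `ℝ⟦X⟧⟦Y⟧`, and comparing coefficients of `xʳ yᵏ` gives an identity
between finite sums (`MZV.sum_truncZeta_eq`). As `N → ∞` its left side tends to `maxHeightSum r k`.
On its right side the last product tends to `1` for fixed `m`, and what remains is the series of
`ζ(1, …, 1, k + 1)` arranged by its largest summation variable `m`. The limit may be taken termwise
by dominated convergence: the coefficient belonging to `m` is bounded, uniformly in `N`, by a power
of the harmonic number `H_m` over `m ^ (k + 1)` (`MZV.tendsto_sum_tailSeries`).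
-/

namespace MZV

open Finset Filter Topology PowerSeries

/-! ### A terminating hypergeometric identity -/

section Field

variable {K : Type*} [Field K]

/-- The Taylor coefficient `(x)_m / m!` of `(1 - t)⁻ˣ`. -/
def risingCoeff (x : K) (m : ℕ) : K := ∏ i ∈ range m, (x + i) / (i + 1)

theorem risingCoeff_succ (x : K) (m : ℕ) :
    risingCoeff x (m + 1) = risingCoeff x m * ((x + m) / (m + 1)) :=
  prod_range_succ _ _

theorem risingCoeff_zero (x : K) : risingCoeff x 0 = 1 := rfl

variable [CharZero K]

/-- Partial sums of the convolution of the Taylor coefficients of `(1 - t)⁻ˣ` and `(1 - t)ˣ`: apart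
from its last term, that convolution telescopes. -/
theorem sum_risingCoeff_mul (x : K) (N p : ℕ) (hp : p ≤ N) :
    ∑ m ∈ range (p + 1),
        x * risingCoeff x m * risingCoeff (1 - x) (N - m) / ((N : K) + 1 - m) =
      (x + p) / (N + 1) * risingCoeff x p * risingCoeff (1 - x) (N - p) := by
  induction p with
  | zero => simp [risingCoeff_zero]; ring
  | succ p ih =>
    obtain ⟨n, rfl⟩ := Nat.exists_eq_add_of_le hp
    rw [sum_range_succ, ih (by omega), show p + 1 + n - p = n + 1 by omega,
      show p + 1 + n - (p + 1) = n by omega, risingCoeff_succ, risingCoeff_succ]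
    have h1 : (n : K) + 1 ≠ 0 := by exact_mod_cast n.succ_ne_zero
    have h2 : (p : K) + 1 ≠ 0 := by exact_mod_cast p.succ_ne_zero
    have h3 : (p : K) + 1 + n + 1 ≠ 0 := by exact_mod_cast (p + 1 + n).succ_ne_zero
    push_cast
    rw [show (p : K) + 1 + n + 1 - (p + 1) = n + 1 by ring]
    field_simp
    ring

/-- A terminating form of Gauss's summation of `₂F₁(x, -y; 1 - y; 1)`. -/
theorem sum_risingCoeff_eq_prod (x y : K) (hy : ∀ n : ℕ, (n : K) - y ≠ 0) (N : ℕ) :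
    ∑ m ∈ range (N + 1),
        -y / ((m : K) - y) * risingCoeff x m * risingCoeff (1 - x) (N - m) =
      ∏ i ∈ range N, ((i : K) + 1 - x - y) / (i + 1 - y) := by
  induction N with
  | zero =>
    have := hy 0
    have h0 : y ≠ 0 := by simpa using this
    simp [risingCoeff_zero, h0]
  | succ N ih =>
    have hN : (N : K) + 1 - y ≠ 0 := by simpa using hy (N + 1)
    -- With `t N m` the summand, `(N + 1 - y) * t (N + 1) m - (N + 1 - x - y) * t N m` is free of the
    -- denominator `m - y`, and its sum over `m ≤ N` is the one evaluated by `sum_risingCoeff_mul`.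
    rw [prod_range_succ, ← ih, mul_div_assoc', eq_div_iff hN, sum_range_succ, add_mul]
    have hN' : (N : K) + 1 ≠ 0 := by exact_mod_cast N.succ_ne_zero
    have key := sum_risingCoeff_mul x N N le_rfl
    have last : -y / (((N + 1 : ℕ) : K) - y) * risingCoeff x (N + 1) *
        risingCoeff (1 - x) (N + 1 - (N + 1)) * ((N : K) + 1 - y) =
        -y * ((x + N) / (N + 1) * risingCoeff x N * risingCoeff (1 - x) (N - N)) := by
      simp only [Nat.sub_self, risingCoeff_zero, risingCoeff_succ]
      push_cast
      field_simp
    rw [last, ← key, mul_sum, sum_mul, sum_mul, ← sum_add_distrib]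
    refine sum_congr rfl fun m hm => ?_
    obtain ⟨n, rfl⟩ := Nat.exists_eq_add_of_le (Nat.lt_succ_iff.1 (mem_range.1 hm))
    rw [show m + n + 1 - m = n + 1 by omega, show m + n - m = n by omega, risingCoeff_succ]
    have h1 : (n : K) + 1 ≠ 0 := by exact_mod_cast n.succ_ne_zero
    have := hy m
    push_cast
    rw [show (m : K) + n + 1 - m = n + 1 by ring]
    field_simp
    ring

theorem risingCoeff_succ_eq_prod_Icc (x : K) (m : ℕ) :
    risingCoeff x (m + 1) = 1 / (m + 1) * x * ∏ i ∈ Icc 1 m, (1 + x * (1 / i)) := by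
  induction m with
  | zero => simp [risingCoeff]
  | succ m ih =>
    rw [risingCoeff_succ, ih, prod_Icc_succ_top (by omega)]
    have h1 : (m : K) + 1 ≠ 0 := by exact_mod_cast m.succ_ne_zero
    push_cast
    field_simp
    ring

theorem risingCoeff_sub_mul_prod (x : K) (hx : ∀ n : ℕ, 0 < n → (n : K) - x ≠ 0) (N m : ℕ)
    (hm : m ≤ N) : risingCoeff (1 - x) (N - m) =
      risingCoeff (1 - x) N * ∏ i ∈ range m, (1 - x / ((N - i : ℕ) : K))⁻¹ := by
  induction m with
  | zero => simp
  | succ m ih =>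
    obtain ⟨n, rfl⟩ := Nat.exists_eq_add_of_le hm
    rw [prod_range_succ, ← mul_assoc, ← ih (by omega), show m + 1 + n - m = n + 1 by omega,
      show m + 1 + n - (m + 1) = n by omega, risingCoeff_succ]
    have h1 : (n : K) + 1 ≠ 0 := by exact_mod_cast n.succ_ne_zero
    have h2 : (n : K) + 1 - x ≠ 0 := by simpa using hx (n + 1) n.succ_pos
    push_cast
    rw [one_sub_div h1, show 1 - x + (n : K) = n + 1 - x by ring]
    field_simp

theorem risingCoeff_one_sub_ne_zero (x : K) (hx : ∀ n : ℕ, 0 < n → (n : K) - x ≠ 0) (N : ℕ) :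
    risingCoeff (1 - x) N ≠ 0 := by
  refine prod_ne_zero_iff.2 fun i _ => div_ne_zero ?_ (by exact_mod_cast i.succ_ne_zero)
  rw [show 1 - x + (i : K) = (i + 1 : ℕ) - x by push_cast; ring]
  exact hx _ i.succ_pos

/-- The partial fraction expansion in `y` of `∏ₙ n (n - x - y) / ((n - x) (n - y))`, normalized
at `y = 0`. -/
theorem prod_one_sub_eq_one_sub_sum (x y : K) (hx : ∀ n : ℕ, 0 < n → (n : K) - x ≠ 0)
    (hy : ∀ n : ℕ, (n : K) - y ≠ 0) (N : ℕ) :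
    ∏ n ∈ Icc 1 N, (1 - x / ((n : K) - x) * (y / (n - y))) =
      1 - ∑ m ∈ range N, 1 / ((m : K) + 1) * x * (∏ i ∈ Icc 1 m, (1 + x * (1 / i))) *
        (∏ i ∈ range (m + 1), (1 - x / ((N - i : ℕ) : K))⁻¹) * (y / ((m + 1 : ℕ) - y)) := by
  have hB := risingCoeff_one_sub_ne_zero x hx N
  have h0 : y ≠ 0 := by simpa using hy 0
  have hprod : ∏ n ∈ Icc 1 N, (1 - x / ((n : K) - x) * (y / (n - y))) =
      (∏ i ∈ range N, ((i : K) + 1 - x - y) / (i + 1 - y)) / risingCoeff (1 - x) N := by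
    have hIcc : Icc 1 N = Ico (0 + 1) (N + 1) := by
      ext
      simp only [mem_Icc, mem_Ico]
      omega
    rw [risingCoeff, ← prod_div_distrib, hIcc, ← prod_Ico_add', range_eq_Ico]
    refine prod_congr rfl fun i _ => ?_
    have h1 : (i : K) + 1 ≠ 0 := by exact_mod_cast i.succ_ne_zero
    have h2 : (i : K) + 1 - x ≠ 0 := by simpa using hx (i + 1) i.succ_pos
    have h3 : (i : K) + 1 - y ≠ 0 := by simpa using hy (i + 1)
    rw [show 1 - x + (i : K) = i + 1 - x by ring]
    push_cast
    field_simp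
    ring
  rw [hprod, ← sum_risingCoeff_eq_prod x y hy, div_eq_iff hB, sum_range_succ', add_comm, sub_mul,
    sum_mul, sub_eq_add_neg (1 * _), ← sum_neg_distrib]
  congr 1
  · simp [risingCoeff_zero, h0]
  · refine sum_congr rfl fun m hm => ?_
    rw [risingCoeff_sub_mul_prod x hx N (m + 1) (mem_range.1 hm), risingCoeff_succ_eq_prod_Icc]
    ring

end Field

/-! ### Generating functions with formal variables -/

/-- The geometric series `(1 - x X)⁻¹`. -/
noncomputable def geom (x : ℝ) : ℝ⟦X⟧ := PowerSeries.mk fun t => x ^ t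

@[simp] theorem coeff_geom (x : ℝ) (t : ℕ) : coeff t (geom x) = x ^ t := coeff_mk _ _

theorem geom_mul_one_sub (x : ℝ) : geom x * (1 - C x * X) = 1 := by
  ext t
  rw [mul_sub, mul_left_comm, map_sub, coeff_C_mul]
  cases t with
  | zero => simp
  | succ t => simp [coeff_succ_mul_X, pow_succ', coeff_one]

/-- The series `∑_{a ≥ 1} Xᵃ / nᵃ = X / (n - X)`. -/
noncomputable def powSeries (n : ℕ) : ℝ⟦X⟧ := X * (C (1 / (n : ℝ)) * geom (1 / n))

theorem coeff_powSeries (n t : ℕ) :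
    coeff t (powSeries n) = if t = 0 then 0 else (1 / (n : ℝ)) ^ t := by
  cases t with
  | zero => simp [powSeries]
  | succ t => simp [powSeries, coeff_succ_X_mul, pow_succ']

theorem powSeries_mul_sub {n : ℕ} (hn : 0 < n) : powSeries n * ((n : ℝ⟦X⟧) - X) = X := by
  have hn' : (n : ℝ) ≠ 0 := by exact_mod_cast hn.ne'
  have h1 : (n : ℝ⟦X⟧) = C (n : ℝ) := by simp
  have h2 : (C (1 / (n : ℝ)) : ℝ⟦X⟧) * C (n : ℝ) = 1 := by
    rw [← map_mul, one_div_mul_cancel hn', map_one]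
  have h3 := geom_mul_one_sub (1 / (n : ℝ))
  rw [powSeries, h1]
  linear_combination X * h3 + X * geom (1 / (n : ℝ)) * h2

/-- The generating polynomial `∏_{i ≤ m} (1 + X / i)` of the elementary symmetric functions of
`1, 1/2, …, 1/m`. -/
noncomputable def elemSeries (m : ℕ) : ℝ⟦X⟧ := ∏ i ∈ Icc 1 m, (1 + X * C (1 / (i : ℝ)))

/-- The generating function `∏_{N - m ≤ i ≤ N} (1 - X / i)⁻¹` of the complete symmetric functions
of `1/N, …, 1/(N - m)`. -/
noncomputable def tailSeries (N m : ℕ) : ℝ⟦X⟧ := ∏ i ∈ range (m + 1), geom (1 / ((N - i : ℕ) : ℝ))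

theorem natCast_sub_X_ne_zero (n : ℕ) : (n : ℝ⟦X⟧) - X ≠ 0 := by
  intro h
  have h1 : (n : ℝ⟦X⟧) = C (n : ℝ) := by simp
  have := congrArg (coeff 1) h
  rw [h1, map_sub, coeff_C, coeff_one_X] at this
  simp at this

/-- The partial fraction identity in `ℝ⟦X⟧⟦Y⟧`; the inner variable enters through `C`, the outer one
through `map C`. -/
theorem prod_one_sub_powSeries (N : ℕ) :
    ∏ n ∈ Icc 1 N, (1 - C (powSeries n) * map C (powSeries n)) =
      1 - ∑ m ∈ range N, C (C (1 / ((m : ℝ) + 1)) * X * elemSeries m * tailSeries N m) *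
        map (C : ℝ →+* ℝ⟦X⟧) (powSeries (m + 1)) := by
  -- `φ₁` and `φ₂` are the two embeddings of `ℝ⟦X⟧` by which the inner and the outer variable
  -- enter the fraction field.
  let F := FractionRing (ℝ⟦X⟧⟦X⟧)
  let φ : ℝ⟦X⟧⟦X⟧ →+* F := algebraMap _ _
  have hφ : Function.Injective φ := IsFractionRing.injective _ _
  let φ₁ : ℝ⟦X⟧ →+* F := φ.comp C
  let φ₂ : ℝ⟦X⟧ →+* F := φ.comp (map C)
  have hφ₁ : Function.Injective φ₁ := hφ.comp (C_injective)
  have hφ₂ : Function.Injective φ₂ := hφ.comp (map_injective _ C_injective)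
  have : CharZero F := charZero_of_injective_ringHom (φ₁.comp C).injective
  have hC (n : ℕ) : φ₁ (C (1 / (n : ℝ))) = 1 / (n : F) := by
    rw [← RingHom.comp_apply, map_div₀, map_one, map_natCast]
  have hx (n : ℕ) : (n : F) - φ₁ X ≠ 0 := by
    rw [← map_natCast φ₁, ← map_sub]
    exact (map_ne_zero_iff φ₁ hφ₁).2 (natCast_sub_X_ne_zero n)
  have hy (n : ℕ) : (n : F) - φ₂ X ≠ 0 := by
    rw [← map_natCast φ₂, ← map_sub]
    exact (map_ne_zero_iff φ₂ hφ₂).2 (natCast_sub_X_ne_zero n)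
  have hP₁ {n : ℕ} (hn : 0 < n) : φ₁ (powSeries n) = φ₁ X / ((n : F) - φ₁ X) := by
    rw [eq_div_iff (hx n), ← map_natCast φ₁, ← map_sub, ← map_mul, powSeries_mul_sub hn]
  have hP₂ {n : ℕ} (hn : 0 < n) : φ₂ (powSeries n) = φ₂ X / ((n : F) - φ₂ X) := by
    rw [eq_div_iff (hy n), ← map_natCast φ₂, ← map_sub, ← map_mul, powSeries_mul_sub hn]
  have hG (n : ℕ) : φ₁ (geom (1 / (n : ℝ))) = (1 - φ₁ X / (n : F))⁻¹ := by
    refine eq_inv_of_mul_eq_one_left ?_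
    have := congrArg φ₁ (geom_mul_one_sub (1 / (n : ℝ)))
    rwa [map_mul, map_sub, map_mul, hC, map_one, one_div_mul_eq_div] at this
  have key := prod_one_sub_eq_one_sub_sum (φ₁ X) (φ₂ X) (fun n _ => hx n) hy N
  apply hφ
  simp only [map_prod, map_sub, map_one, map_sum, map_mul, elemSeries, tailSeries]
  have e₁ (a : ℝ⟦X⟧) : φ (C a) = φ₁ a := rfl
  have e₂ (a : ℝ⟦X⟧) : φ (map C a) = φ₂ a := rfl
  simp only [map_mul, map_add, map_one, e₁, e₂, hC, hG]
  refine Eq.trans (prod_congr rfl fun n hn => ?_) (key.trans ?_)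
  · rw [hP₁ (mem_Icc.1 hn).1, hP₂ (mem_Icc.1 hn).1]
  · refine congrArg _ (sum_congr rfl fun m _ => ?_)
    have := hC (m + 1)
    push_cast at this
    rw [hP₂ m.succ_pos, this]

theorem coeff_coeff_C_mul_map_C (f g : ℝ⟦X⟧) (r k : ℕ) :
    coeff r (coeff k (C f * map C g)) = coeff r f * coeff k g := by
  rw [coeff_C_mul, coeff_map, coeff_mul_C]

theorem coeff_coeff_prod_one_sub (N r k : ℕ) :
    coeff (r + 1) (coeff (k + 1)
        (∏ n ∈ Icc 1 N, (1 - C (powSeries n) * map (C : ℝ →+* ℝ⟦X⟧) (powSeries n)))) =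
      -∑ m ∈ range N, (1 / ((m : ℝ) + 1)) ^ (k + 2) * coeff r (elemSeries m * tailSeries N m) := by
  rw [prod_one_sub_powSeries, map_sub, map_sub, map_sum, map_sum]
  simp only [coeff_coeff_C_mul_map_C]
  simp only [mul_assoc, coeff_C_mul, coeff_succ_X_mul, coeff_powSeries]
  rw [coeff_one, if_neg k.succ_ne_zero, map_zero, zero_sub, neg_inj]
  refine sum_congr rfl fun m _ => ?_
  rw [if_neg k.succ_ne_zero]
  push_cast
  ring

theorem coeff_prod_powSeries_eq_zero {s : Finset ℕ} {t : ℕ} (h : t < s.card) :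
    coeff t (∏ n ∈ s, powSeries n) = 0 := by
  simp only [powSeries, prod_mul_distrib, prod_const]
  rw [coeff_X_pow_mul', if_neg (not_le.2 h)]

theorem coeff_coeff_prod_one_sub_eq_sum (N : ℕ) {r k : ℕ} (hr : 1 ≤ r) :
    coeff r (coeff k
        (∏ n ∈ Icc 1 N, (1 - C (powSeries n) * map (C : ℝ →+* ℝ⟦X⟧) (powSeries n)))) =
      ∑ j ∈ Icc 1 (min r k), (-1) ^ j * ∑ s ∈ powersetCard j (Icc 1 N),
        coeff k (∏ n ∈ s, powSeries n) * coeff r (∏ n ∈ s, powSeries n) := by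
  have hterm (s : Finset ℕ) : coeff r (coeff k
      (∏ n ∈ s, -(C (powSeries n) * map (C : ℝ →+* ℝ⟦X⟧) (powSeries n)))) =
      (-1) ^ s.card * (coeff k (∏ n ∈ s, powSeries n) * coeff r (∏ n ∈ s, powSeries n)) := by
    rw [prod_neg, prod_mul_distrib, ← map_prod, ← map_prod]
    rw [show (-1 : ℝ⟦X⟧⟦X⟧) ^ s.card = C (C ((-1) ^ s.card)) by simp, coeff_C_mul, coeff_C_mul,
      coeff_coeff_C_mul_map_C, mul_comm (coeff r _)]
  simp only [sub_eq_add_neg]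
  rw [prod_one_add, map_sum, map_sum, sum_congr rfl fun s _ => hterm s]
  have hsplit := sum_fiberwise_eq_sum_filter (Icc 1 N).powerset (Icc 1 (min r k)) card
    fun s => (-1 : ℝ) ^ s.card * (coeff k (∏ n ∈ s, powSeries n) * coeff r (∏ n ∈ s, powSeries n))
  rw [sum_filter_of_ne] at hsplit
  · rw [← hsplit]
    refine sum_congr rfl fun j _ => ?_
    rw [mul_sum, powersetCard_eq_filter]
    refine sum_congr rfl fun s hs => ?_
    rw [(mem_filter.1 hs).2]
  · intro s _ hs
    have hk : s.card ≤ k := by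
      by_contra h
      exact hs (by rw [coeff_prod_powSeries_eq_zero (not_le.1 h)]; ring)
    have hr' : s.card ≤ r := by
      by_contra h
      exact hs (by rw [coeff_prod_powSeries_eq_zero (not_le.1 h)]; ring)
    refine mem_Icc.2 ⟨Nat.one_le_iff_ne_zero.2 fun h0 => ?_, le_min hr' hk⟩
    rw [card_eq_zero.1 h0] at hs
    simp [coeff_one, Nat.one_le_iff_ne_zero.1 hr] at hs

theorem coeff_elemSeries (m t : ℕ) :
    coeff t (elemSeries m) = ∑ s ∈ powersetCard t (Icc 1 m), ∏ i ∈ s, 1 / (i : ℝ) := by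
  rw [elemSeries, prod_one_add, map_sum, powersetCard_eq_filter, sum_filter]
  refine sum_congr rfl fun s _ => ?_
  rw [prod_mul_distrib, prod_const, ← map_prod, coeff_mul_C, coeff_X_pow]
  simp [eq_comm]

/-! ### Coefficientwise bounds and the limit of the tail factor -/

/-- The coefficients of `f` are nonnegative and bounded by the powers of `c`. -/
def Majorized (f : ℝ⟦X⟧) (c : ℝ) : Prop := ∀ t, 0 ≤ coeff t f ∧ coeff t f ≤ c ^ t

theorem Majorized.mul {f g : ℝ⟦X⟧} {c d : ℝ} (hf : Majorized f c) (hg : Majorized g d) :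
    Majorized (f * g) (c + d) := by
  intro t
  rw [coeff_mul]
  have hc : 0 ≤ c := by simpa using (hf 1).1.trans (hf 1).2
  have hd : 0 ≤ d := by simpa using (hg 1).1.trans (hg 1).2
  refine ⟨sum_nonneg fun p _ => mul_nonneg (hf _).1 (hg _).1, ?_⟩
  rw [(Commute.all c d).add_pow']
  refine sum_le_sum fun p hp => ?_
  have h1 : coeff p.1 f * coeff p.2 g ≤ c ^ p.1 * d ^ p.2 :=
    mul_le_mul (hf _).2 (hg _).2 (hg _).1 (by positivity)
  refine h1.trans ?_
  rw [nsmul_eq_mul]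
  refine le_mul_of_one_le_left (by positivity) ?_
  exact_mod_cast Nat.choose_pos (by have := mem_antidiagonal.1 hp; omega)

theorem Majorized.prod {ι : Type*} (s : Finset ι) (f : ι → ℝ⟦X⟧) (c : ι → ℝ)
    (h : ∀ i ∈ s, Majorized (f i) (c i)) : Majorized (∏ i ∈ s, f i) (∑ i ∈ s, c i) := by
  classical
  induction s using Finset.induction_on with
  | empty =>
    intro t
    cases t <;> simp [coeff_one]
  | insert a s ha ih =>
    rw [prod_insert ha, sum_insert ha]
    exact (h a (mem_insert_self _ _)).mul (ih fun i hi => h i (mem_insert_of_mem hi))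

theorem Majorized.mono {f : ℝ⟦X⟧} {c d : ℝ} (hf : Majorized f c) (h : c ≤ d) : Majorized f d :=
  fun t => ⟨(hf t).1, (hf t).2.trans
    (pow_le_pow_left₀ (by simpa using (hf 1).1.trans (hf 1).2) h t)⟩

theorem majorized_geom {x : ℝ} (hx : 0 ≤ x) : Majorized (geom x) x :=
  fun t => by simp [pow_nonneg hx]

theorem majorized_one_add {x : ℝ} (hx : 0 ≤ x) : Majorized (1 + X * C x) x := by
  intro t
  rcases t with _ | _ | t
  · simp
  · simp [coeff_one, hx]
  · simp only [map_add, coeff_one, coeff_succ_X_mul, coeff_C]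
    simpa using pow_nonneg hx (t + 2)

theorem majorized_elemSeries (m : ℕ) : Majorized (elemSeries m) (harmonic (m + 1)) := by
  refine (Majorized.prod _ _ _ fun i _ => majorized_one_add (by positivity)).mono ?_
  rw [harmonic_eq_sum_Icc]
  push_cast
  simp only [one_div]
  exact sum_le_sum_of_subset_of_nonneg (Icc_subset_Icc_right (by omega)) fun _ _ _ => by positivity

/-- The bound does not depend on `N`: the `m + 1` reciprocals `1/(N - m), …, 1/N` are dominated by
`1, …, 1/(m + 1)`. -/
theorem majorized_tailSeries {N m : ℕ} (h : m < N) :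
    Majorized (tailSeries N m) (harmonic (m + 1)) := by
  refine (Majorized.prod _ _ _ fun i _ => majorized_geom (by positivity)).mono ?_
  rw [harmonic, ← sum_range_reflect, Rat.cast_sum]
  refine sum_le_sum fun i hi => ?_
  rw [Rat.cast_inv, Rat.cast_natCast]
  have := mem_range.1 hi
  rw [one_div]
  refine inv_anti₀ (by positivity) ?_
  exact_mod_cast (by omega : i + 1 ≤ N - (m + 1 - 1 - i))

theorem coeff_mul_tailSeries_mem {N m : ℕ} (h : m < N) (t : ℕ) :
    0 ≤ coeff t (elemSeries m * tailSeries N m) ∧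
      coeff t (elemSeries m * tailSeries N m) ≤ (2 * (harmonic (m + 1) : ℝ)) ^ t := by
  rw [two_mul]
  exact (majorized_elemSeries m).mul (majorized_tailSeries h) t

open scoped PowerSeries.WithPiTopology in
theorem tendsto_coeff_mul_tailSeries (m t : ℕ) :
    Tendsto (fun N => coeff t (elemSeries m * tailSeries N m)) atTop
      (𝓝 (coeff t (elemSeries m))) := by
  have h : Tendsto (fun N => tailSeries N m) atTop (𝓝 1) := by
    rw [← prod_const_one (s := range (m + 1))]
    refine tendsto_finsetProd _ fun i _ => ?_
    rw [PowerSeries.WithPiTopology.tendsto_iff_coeff_tendsto]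
    intro d
    have h0 : Tendsto (fun N : ℕ => 1 / ((N - i : ℕ) : ℝ)) atTop (𝓝 0) :=
      tendsto_one_div_atTop_nhds_zero_nat.comp (tendsto_sub_atTop_nat i)
    simp only [coeff_geom]
    convert h0.pow d using 2
    cases d <;> simp [coeff_one]
  have := ((PowerSeries.WithPiTopology.continuous_coeff ℝ t).tendsto _).comp
    (h.const_mul (elemSeries m))
  simpa [Function.comp_def] using this

theorem summable_harmonic_pow_div (t k : ℕ) :
    Summable fun m : ℕ => (1 / ((m : ℝ) + 1)) ^ (k + 2) * (2 * (harmonic (m + 1) : ℝ)) ^ t := by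
  -- `H_n ≤ 1 + log n = O(n ^ ε)` with `ε t ≤ 1 / 2`, so the terms are `O(n ^ (-3/2))`.
  set ε : ℝ := 1 / (2 * (t + 1)) with hε
  have hε0 : 0 < ε := by positivity
  have hεt : ε * t ≤ 1 / 2 := by
    rw [hε, div_mul_eq_mul_div, div_le_div_iff₀ (by positivity) (by norm_num)]
    linarith
  set c : ℝ := 2 * (1 + 1 / ε) with hc
  have hsum : Summable fun m : ℕ => c ^ t * (1 / ((m + 1 : ℕ) : ℝ) ^ (3 / 2 : ℝ)) :=
    ((summable_nat_add_iff 1).2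
      (Real.summable_one_div_nat_rpow.2 (by norm_num : (1 : ℝ) < 3 / 2))).mul_left _
  have hharm (m : ℕ) : 0 ≤ (harmonic (m + 1) : ℝ) := by
    exact_mod_cast (harmonic_pos m.succ_ne_zero).le
  refine hsum.of_nonneg_of_le (fun m => ?_) fun m => ?_
  · have := hharm m
    positivity
  set n : ℝ := ((m + 1 : ℕ) : ℝ) with hn
  have hn1 : 1 ≤ n := by rw [hn]; exact_mod_cast Nat.succ_pos m
  have hn0 : 0 < n := by linarith
  have h1 : 2 * (harmonic (m + 1) : ℝ) ≤ c * n ^ ε := by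
    have h2 := harmonic_le_one_add_log (m + 1)
    have h3 := Real.log_le_rpow_div hn0.le hε0
    have h4 := Real.one_le_rpow hn1 hε0.le
    have h5 : c * n ^ ε = 2 * (n ^ ε + n ^ ε / ε) := by rw [hc]; ring
    rw [h5]
    linarith
  have h2 : (2 * (harmonic (m + 1) : ℝ)) ^ t ≤ c ^ t * n ^ (1 / 2 : ℝ) := by
    refine (pow_le_pow_left₀ (by have := hharm m; positivity) h1 t).trans ?_
    rw [mul_pow, ← Real.rpow_mul_natCast hn0.le]
    gcongr
  have h3 : (1 / ((m : ℝ) + 1)) ^ (k + 2) ≤ 1 / n ^ 2 := by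
    rw [one_div_pow, hn]
    push_cast
    refine one_div_le_one_div_of_le (by positivity) (pow_le_pow_right₀ ?_ (by omega))
    linarith [(Nat.cast_nonneg m : (0 : ℝ) ≤ m)]
  calc _ ≤ 1 / n ^ 2 * (c ^ t * n ^ (1 / 2 : ℝ)) :=
        mul_le_mul h3 h2 (by have := hharm m; positivity) (by positivity)
    _ = c ^ t * (1 / n ^ (3 / 2 : ℝ)) := by
        have h4 : n ^ (3 / 2 : ℝ) * n ^ (1 / 2 : ℝ) = n ^ 2 := by
          rw [← Real.rpow_add hn0, ← Real.rpow_natCast]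
          norm_num
        rw [← h4]
        have := Real.rpow_pos_of_pos hn0 (1 / 2)
        field_simp

/-! ### Truncated multiple zeta values -/

/-- The chains `0 < m₁ < ⋯ < m_r ≤ N`. -/
noncomputable def truncChains (r N : ℕ) : Finset (chains r) :=
  open Classical in (Fintype.piFinset fun _ => Icc 1 N).subtype (· ∈ chains r)

theorem mem_truncChains {r N : ℕ} {m : chains r} :
    m ∈ truncChains r N ↔ ∀ i, (m : Fin r → ℕ) i ≤ N := by
  simp only [truncChains, mem_subtype, Fintype.mem_piFinset, mem_Icc]
  exact forall_congr' fun i => and_iff_right (m.2.1 i)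

theorem tendsto_truncChains (r : ℕ) : Tendsto (truncChains r) atTop atTop := by
  refine tendsto_atTop_finset_of_monotone (fun M N h m hm => ?_) fun m => ?_
  · rw [mem_truncChains] at *
    exact fun i => (hm i).trans h
  · exact ⟨∑ i, (m : Fin r → ℕ) i, mem_truncChains.2 fun i =>
      single_le_sum (fun _ _ => Nat.zero_le _) (mem_univ i)⟩

/-- The truncation `ζ_N(k)` of the multiple zeta value to `m_r ≤ N`. -/
noncomputable def truncZeta {r : ℕ} (k : Fin r → ℕ) (N : ℕ) : ℝ :=
  ∑ m ∈ truncChains r N, term k m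

theorem Converges.tendsto_truncZeta {r : ℕ} {k : Fin r → ℕ} (h : Converges k) :
    Tendsto (truncZeta k) atTop (𝓝 (zeta k)) :=
  h.hasSum.comp (tendsto_truncChains r)

theorem term_nonneg {r : ℕ} (k m : Fin r → ℕ) : 0 ≤ term k m := by
  unfold term
  positivity

theorem converges_of_truncZeta_le {r : ℕ} {k : Fin r → ℕ} {c : ℝ} (h : ∀ N, truncZeta k N ≤ c) :
    Converges k := by
  refine summable_of_sum_le (fun m => term_nonneg k m) (c := c) fun u => ?_
  obtain ⟨N, hN⟩ := ((tendsto_truncChains r).eventually_ge_atTop u).exists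
  exact (sum_le_sum_of_subset_of_nonneg hN fun m _ _ => term_nonneg k m).trans (h N)

/-- A chain is determined by the set of its entries. -/
theorem sum_truncChains (r N : ℕ) (g : Finset ℕ → ℝ) :
    ∑ m ∈ truncChains r N, g (univ.image (m : Fin r → ℕ)) =
      ∑ s ∈ powersetCard r (Icc 1 N), g s := by
  refine sum_nbij (fun m => univ.image (m : Fin r → ℕ)) (fun m hm => ?_) (fun m _ m' _ h => ?_)
    (fun s hs => ?_) fun _ _ => rfl
  · rw [mem_powersetCard, card_image_of_injective _ m.2.2.injective, card_univ, Fintype.card_fin]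
    refine ⟨fun x hx => ?_, rfl⟩
    obtain ⟨i, _, rfl⟩ := mem_image.1 hx
    exact mem_Icc.2 ⟨m.2.1 i, mem_truncChains.1 hm i⟩
  · refine Subtype.ext ((StrictMono.range_inj m.2.2 m'.2.2).1 ?_)
    simpa using congrArg ((↑) : Finset ℕ → Set ℕ) h
  · obtain ⟨hs, hr⟩ := mem_powersetCard.1 (mem_coe.1 hs)
    have hmem (i : Fin r) := mem_Icc.1 (hs (orderEmbOfFin_mem s hr i))
    refine ⟨⟨s.orderEmbOfFin hr, fun i => (hmem i).1, (s.orderEmbOfFin hr).strictMono⟩,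
      mem_coe.2 (mem_truncChains.2 fun i => (hmem i).2), ?_⟩
    exact image_orderEmbOfFin_univ s hr

theorem prod_image_chain {r : ℕ} {M : Type*} [CommMonoid M] (m : chains r) (f : ℕ → M) :
    ∏ n ∈ univ.image (m : Fin r → ℕ), f n = ∏ i, f ((m : Fin r → ℕ) i) :=
  prod_image fun _ _ _ _ h => m.2.2.injective h

/-- Summing over all exponents of a given weight extracts a coefficient of a product of geometric
series. -/
theorem sum_indices_term {j : ℕ} (k : ℕ) (m : chains j) :
    ∑ a ∈ indices j k, term a m = coeff k (∏ n ∈ univ.image (m : Fin j → ℕ), powSeries n) := by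
  rw [prod_image_chain, coeff_prod]
  refine sum_of_injOn Finsupp.equivFunOnFinite.symm
    (Finsupp.equivFunOnFinite.symm.injective.injOn) (fun a ha => ?_) (fun l hl hl' => ?_)
    fun a ha => ?_
  · rw [mem_coe, mem_finsuppAntidiag]
    exact ⟨(mem_indices.1 ha).2, subset_univ _⟩
  · by_contra h
    refine hl' ⟨l, mem_coe.2 (mem_indices.2 ⟨fun i => Nat.pos_of_ne_zero fun h0 => ?_,
      (mem_finsuppAntidiag.1 hl).1⟩), by ext; rfl⟩
    exact h (prod_eq_zero (mem_univ i) (by rw [coeff_powSeries, if_pos h0]))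
  · rw [term, one_div, ← prod_inv_distrib]
    refine prod_congr rfl fun i _ => ?_
    rw [Finsupp.equivFunOnFinite_symm_apply_apply, coeff_powSeries,
      if_neg ((mem_indices.1 ha).1 i).ne', one_div_pow, one_div]

theorem term_add {j : ℕ} (a b m : Fin j → ℕ) : term (a + b) m = term a m * term b m := by
  simp only [term, Pi.add_apply, pow_add, prod_mul_distrib]
  rw [one_div_mul_one_div]

theorem sum_indices_truncZeta (j r k N : ℕ) :
    ∑ a ∈ indices j k, ∑ b ∈ indices j r, truncZeta (a + b) N =
      ∑ s ∈ powersetCard j (Icc 1 N),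
        coeff k (∏ n ∈ s, powSeries n) * coeff r (∏ n ∈ s, powSeries n) := by
  rw [← sum_truncChains j N fun s =>
    coeff k (∏ n ∈ s, powSeries n) * coeff r (∏ n ∈ s, powSeries n)]
  simp only [truncZeta, ← sum_indices_term, sum_mul_sum, term_add]
  rw [sum_congr rfl fun a _ => sum_comm, sum_comm]

theorem term_heightOneIndex {r : ℕ} (k : ℕ) (m : chains (r + 1)) :
    term (heightOneIndex (r + 1) k) m =
      (∏ n ∈ univ.image (m : Fin (r + 1) → ℕ), 1 / (n : ℝ)) *
        (1 / ((univ.image (m : Fin (r + 1) → ℕ)).sup id : ℕ)) ^ k := by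
  have hsup : (univ.image (m : Fin (r + 1) → ℕ)).sup id = (m : Fin (r + 1) → ℕ) (Fin.last r) := by
    refine le_antisymm (Finset.sup_le fun x hx => ?_)
      (le_sup (f := id) (mem_image_of_mem _ (mem_univ _)))
    obtain ⟨i, _, rfl⟩ := mem_image.1 hx
    exact m.2.2.monotone (Fin.le_last i)
  rw [hsup, prod_image_chain, term, Fin.prod_univ_castSucc, Fin.prod_univ_castSucc]
  have h (i : Fin r) : heightOneIndex (r + 1) k i.castSucc = 1 := by
    simp [heightOneIndex, i.2.ne]
  have h' : heightOneIndex (r + 1) k (Fin.last r) = k + 1 := by simp [heightOneIndex]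
  simp only [h, h', pow_succ, pow_zero, one_mul, one_div, prod_inv_distrib, mul_inv, inv_pow]
  ring

/-- The sum over the chains `m₁ < ⋯ < m_{r+1}`, arranged by the last entry. -/
theorem truncZeta_heightOneIndex (r k N : ℕ) :
    truncZeta (heightOneIndex (r + 1) k) N =
      ∑ m ∈ range N, (1 / ((m : ℝ) + 1)) ^ (k + 1) * coeff r (elemSeries m) := by
  simp only [truncZeta, term_heightOneIndex]
  rw [sum_truncChains (r + 1) N fun s => (∏ n ∈ s, 1 / (n : ℝ)) * (1 / (s.sup id : ℕ)) ^ k]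
  induction N with
  | zero =>
    rw [Icc_eq_empty (by simp), powersetCard_eq_empty.2 (by simp)]
    simp
  | succ N ih =>
    have hN : N + 1 ∉ Icc 1 N := by simp
    rw [sum_range_succ, ← ih, ← insert_Icc_right_eq_Icc_add_one (by omega),
      powersetCard_succ_insert hN, sum_union]
    · congr 1
      rw [coeff_elemSeries, mul_sum, sum_image]
      · refine sum_congr rfl fun s hs => ?_
        have hs' := (mem_powersetCard.1 hs).1
        have hsup : (insert (N + 1) s).sup id = N + 1 := by
          rw [sup_insert, id, sup_eq_left]
          exact Finset.sup_le fun x hx => (mem_Icc.1 (hs' hx)).2.trans N.le_succ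
        rw [prod_insert fun h => hN (hs' h), hsup]
        push_cast
        ring
      · intro s hs t ht h
        have hs' := fun h => hN ((mem_powersetCard.1 hs).1 h)
        have ht' := fun h => hN ((mem_powersetCard.1 ht).1 h)
        rw [← erase_insert hs', h, erase_insert ht']
    · rw [disjoint_left]
      intro s hs hs'
      obtain ⟨t, _, rfl⟩ := mem_image.1 hs'
      exact hN ((mem_powersetCard.1 hs).1 (mem_insert_self _ _))

/-! ### Convergence and passage to the limit -/

theorem summable_heightOne (r k : ℕ) :
    Summable fun m : ℕ => (1 / ((m : ℝ) + 1)) ^ (k + 2) * coeff r (elemSeries m) := by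
  refine (summable_harmonic_pow_div r k).of_nonneg_of_le
    (fun m => mul_nonneg (by positivity) (majorized_elemSeries m r).1) fun m => ?_
  have h := (majorized_elemSeries m).mono
    (d := 2 * (harmonic (m + 1) : ℝ)) ?_
  · exact mul_le_mul_of_nonneg_left (h r).2 (by positivity)
  · have : (0 : ℝ) < harmonic (m + 1) := by exact_mod_cast harmonic_pos m.succ_ne_zero
    linarith

theorem converges_heightOneIndex (r k : ℕ) : Converges (heightOneIndex (r + 1) (k + 1)) := by
  refine converges_of_truncZeta_le (fun N => ?_) (c := ∑' m : ℕ, (1 / ((m : ℝ) + 1)) ^ (k + 2) *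
    coeff r (elemSeries m))
  rw [truncZeta_heightOneIndex]
  exact (summable_heightOne r k).sum_le_tsum _ fun m _ =>
    mul_nonneg (by positivity) (majorized_elemSeries m r).1

theorem zeta_heightOneIndex (r k : ℕ) : zeta (heightOneIndex (r + 1) (k + 1)) =
    ∑' m : ℕ, (1 / ((m : ℝ) + 1)) ^ (k + 2) * coeff r (elemSeries m) := by
  refine tendsto_nhds_unique (converges_heightOneIndex r k).tendsto_truncZeta ?_
  rw [funext (truncZeta_heightOneIndex r (k + 1))]
  exact (summable_heightOne r k).hasSum.tendsto_sum_nat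

/-- Exponents that are all at least two give a series dominated by that of `(1, …, 1, 2)`. -/
theorem converges_of_two_le {r : ℕ} {k : Fin (r + 1) → ℕ} (hk : ∀ i, 2 ≤ k i) : Converges k := by
  refine (converges_heightOneIndex r 0).of_nonneg_of_le (fun m => term_nonneg k m) fun m => ?_
  have hpos (i) : (1 : ℝ) ≤ (m : Fin (r + 1) → ℕ) i := by exact_mod_cast m.2.1 i
  refine one_div_le_one_div_of_le (prod_pos fun i _ => pow_pos (by linarith [hpos i]) _) ?_
  refine prod_le_prod (fun i _ => by positivity) fun i _ => pow_le_pow_right₀ (hpos i) ?_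
  refine le_trans ?_ (hk i)
  unfold heightOneIndex
  split_ifs <;> omega

theorem two_le_add_of_mem_indices {j k r : ℕ} {a b : Fin j → ℕ} (ha : a ∈ indices j k)
    (hb : b ∈ indices j r) (i : Fin j) : 2 ≤ (a + b) i :=
  Nat.add_le_add ((mem_indices.1 ha).1 i) ((mem_indices.1 hb).1 i)

theorem converges_add {j k r : ℕ} (hj : 1 ≤ j) {a b : Fin j → ℕ} (ha : a ∈ indices j k)
    (hb : b ∈ indices j r) : Converges (a + b) := by
  obtain ⟨j, rfl⟩ := Nat.exists_eq_add_of_le' hj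
  exact converges_of_two_le (two_le_add_of_mem_indices ha hb)

theorem height_add {j k r : ℕ} {a b : Fin j → ℕ} (ha : a ∈ indices j k)
    (hb : b ∈ indices j r) : height (a + b) = j := by
  rw [height, filter_true_of_mem fun i _ => Nat.succ_le_iff.1 (two_le_add_of_mem_indices ha hb i),
    card_univ, Fintype.card_fin]

theorem tendsto_truncZeta_maxHeightSum (r k : ℕ) :
    Tendsto (fun N => ∑ j ∈ Icc 1 (min r k),
      (-1 : ℝ) ^ (j - 1) * ∑ a ∈ indices j k, ∑ b ∈ indices j r, truncZeta (a + b) N) atTop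
      (𝓝 (maxHeightSum r k)) :=
  tendsto_finsetSum _ fun _ hj => Tendsto.const_mul _ <|
    tendsto_finsetSum _ fun _ ha => tendsto_finsetSum _ fun _ hb =>
      (converges_add (mem_Icc.1 hj).1 ha hb).tendsto_truncZeta

/-- The finite identity behind the theorem: its left side is the truncated right side of the
formula, and on its right the factor `tailSeries` is what truncation adds to the height one
value. -/
theorem sum_truncZeta_eq (r k N : ℕ) :
    ∑ j ∈ Icc 1 (min (r + 1) (k + 1)), (-1 : ℝ) ^ (j - 1) *
        ∑ a ∈ indices j (k + 1), ∑ b ∈ indices j (r + 1), truncZeta (a + b) N =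
      ∑ m ∈ range N, (1 / ((m : ℝ) + 1)) ^ (k + 2) *
        coeff r (elemSeries m * tailSeries N m) := by
  have h := (coeff_coeff_prod_one_sub_eq_sum N (k := k + 1) r.succ_pos).symm.trans
    (coeff_coeff_prod_one_sub N r k)
  rw [← neg_inj, ← h, ← sum_neg_distrib]
  refine sum_congr rfl fun j hj => ?_
  obtain ⟨i, rfl⟩ := Nat.exists_eq_add_of_le' (mem_Icc.1 hj).1
  rw [sum_indices_truncZeta, Nat.add_sub_cancel, pow_succ]
  ring

/-- Dominated convergence over the last summation variable `m`. -/
theorem tendsto_sum_tailSeries (r k : ℕ) :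
    Tendsto (fun N => ∑ m ∈ range N, (1 / ((m : ℝ) + 1)) ^ (k + 2) *
      coeff r (elemSeries m * tailSeries N m)) atTop
      (𝓝 (∑' m : ℕ, (1 / ((m : ℝ) + 1)) ^ (k + 2) * coeff r (elemSeries m))) := by
  have hind (N : ℕ) : ∑ m ∈ range N, (1 / ((m : ℝ) + 1)) ^ (k + 2) *
      coeff r (elemSeries m * tailSeries N m) =
      ∑' m : ℕ, if m < N then (1 / ((m : ℝ) + 1)) ^ (k + 2) *
        coeff r (elemSeries m * tailSeries N m) else 0 := by
    rw [tsum_eq_sum (s := range N) fun m hm => if_neg (by simpa using hm)]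
    exact sum_congr rfl fun m hm => (if_pos (mem_range.1 hm)).symm
  simp only [hind]
  refine tendsto_tsum_of_dominated_convergence (summable_harmonic_pow_div r k) (fun m => ?_)
    (Eventually.of_forall fun N m => ?_)
  · refine ((tendsto_coeff_mul_tailSeries m r).const_mul _).congr' ?_
    filter_upwards [eventually_gt_atTop m] with N hN
    rw [if_pos hN]
  · have hharm : (0 : ℝ) ≤ harmonic (m + 1) := by exact_mod_cast (harmonic_pos m.succ_ne_zero).le
    split_ifs with h
    · have := coeff_mul_tailSeries_mem h r
      rw [Real.norm_of_nonneg (mul_nonneg (by positivity) this.1)]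
      exact mul_le_mul_of_nonneg_left this.2 (by positivity)
    · rw [norm_zero]
      positivity

theorem maxHeightSum_comm (r k : ℕ) : maxHeightSum r k = maxHeightSum k r := by
  rw [maxHeightSum, maxHeightSum, min_comm]
  refine sum_congr rfl fun j _ => ?_
  rw [sum_comm]
  simp only [add_comm]

end MZV

theorem theorem1 (r k : ℕ) (hr : 1 ≤ r) (hk : 1 ≤ k) :
    MZV.Converges (MZV.heightOneIndex r k) ∧
    (∀ j ∈ Finset.Icc 1 (min r k), ∀ a ∈ MZV.indices j k, ∀ b ∈ MZV.indices j r,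
      MZV.Converges (a + b) ∧ MZV.height (a + b) = j) ∧
    MZV.zeta (MZV.heightOneIndex r k) = MZV.maxHeightSum r k ∧
    MZV.maxHeightSum r k = MZV.maxHeightSum k r := by
  obtain ⟨r, rfl⟩ := Nat.exists_eq_add_of_le' hr
  obtain ⟨k, rfl⟩ := Nat.exists_eq_add_of_le' hk
  refine ⟨MZV.converges_heightOneIndex r k, fun j hj a ha b hb =>
    ⟨MZV.converges_add (Finset.mem_Icc.1 hj).1 ha hb, MZV.height_add ha hb⟩, ?_,
    MZV.maxHeightSum_comm _ _⟩
  rw [MZV.zeta_heightOneIndex]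
  refine tendsto_nhds_unique (MZV.tendsto_sum_tailSeries r k) ?_
  simp only [← MZV.sum_truncZeta_eq]
  exact MZV.tendsto_truncZeta_maxHeightSum _ _
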